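/- Let $\alpha\in(0,\tfrac12)$ be irrational, with continued fraction expansion $\alpha=[0;a_1,a_2,a_3,\ldots]$ (so $a_1\ge 2$). A Sturmian word of slope $\alpha$ is an infinite word $\nu(x)\,\nu(R(x))\,\nu(R^2(x))\cdots$ over $\{0,1\}$ with $x\in[0,1)$, where $R(x)=\{x+\alpha\}$ is the rotation of the circle $[0,1)$ by $\alpha$, and $\nu$ takes the value $0$ on $I_0$ and $1$ on $I_1$, with either $I_0=[0,1-\alpha)$, $I_1=[1-\alpha,1)$ or $I_0=(0,1-\alpha]$, $I_1=(1-\alpha,1]$ (the points $0$ and $1$ of the circle being identified). Let $\mathcal L(\alpha)$ be the set of all factors of Sturmian words of slope $\alpha$. The standard words are defined by $s_0=0$, $s_1=0^{a_1-1}1$ and $s_k=s_{k-1}^{a_k}s_{k-2}$ for $k\ge 2$; the semistandard words are $s_{k,l}=s_{k-1}^{\,l}s_{k-2}$ for $k\ge2$ and $0<l<a_k$. A word is primitive if it is not a non-trivial power of some word (in particular, the empty word is not primitive), and two words are conjugate if one is a cyclic shift of the other. Let $w\in\mathcal L(\alpha)$ be primitive. 1. If $w^2\in\mathcal L(\alpha)$,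 then $w$ is conjugate to $s_k$ for some $k\ge 0$, or to $s_{k,l}$ for some $k\ge2$ and $0<l<a_k$. 2. If $w^3\in\mathcal L(\alpha)$, then either $w=0$ and $a_1>2$, or $w$ is conjugate to $s_k$ for some $k\ge1$. -/

import Mathlib

open scoped List

namespace Sturmian

section Words

variable {A : Type*}

/-- The integral power `w ^ n` of a word: the concatenation of `n` copies of `w`. -/
def wordPow (w : List A) (n : ℕ) : List A := (List.replicate n w).flatten

/-- A word is primitive if it is not a non-trivial power of some word. The empty word is not
primitive, because it is its own square. -/
def IsPrimitive (w : List A) : Prop := ∀ (u : List A) (n : ℕ), w = wordPow u n → n = 1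

/-- The finite word `w` is a factor of the right-infinite word `s`. -/
def IsFactor (w : List A) (s : ℕ → A) : Prop :=
  ∃ i : ℕ, ∀ (j : ℕ) (hj : j < w.length), w[j] = s (i + j)

end Words

/-- The rotation `x ↦ {x + α}` of the circle `[0, 1)`. -/
noncomputable def rotation (α x : ℝ) : ℝ := Int.fract (x + α)

theorem rotation_iterate (α : ℝ) {x : ℝ} (hx : x ∈ Set.Ico (0 : ℝ) 1) (n : ℕ) :
    (rotation α)^[n] x = Int.fract (x + n * α) := by
  induction n with
  | zero => simpa using (Int.fract_eq_self.2 hx).symm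
  | succ n ih =>
    rw [Function.iterate_succ_apply', ih, rotation, Int.fract_eq_fract]
    refine ⟨-⌊x + n * α⌋, ?_⟩
    rw [Int.fract]
    push_cast
    ring

open Classical in
/-- Coding of the orbit of `x`, for `I₀ = [0, 1 - α)` and `I₁ = [1 - α, 1)`. -/
noncomputable def lowerCoding (α x : ℝ) (n : ℕ) : Fin 2 :=
  if (rotation α)^[n] x ∈ Set.Ico 0 (1 - α) then 0 else 1

open Classical in
/-- Coding of the orbit of `x`, for `I₀ = (0, 1 - α]` and `I₁ = (1 - α, 1]`, where the point `1`
is the point `0` of the circle. -/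
noncomputable def upperCoding (α x : ℝ) (n : ℕ) : Fin 2 :=
  if (rotation α)^[n] x ∈ Set.Ioc 0 (1 - α) then 0 else 1

/-- The Sturmian words of slope `α`: the codings of orbits of the rotation by `α`, for either
choice of the half-open intervals. -/
def IsSturmianOfSlope (α : ℝ) (s : ℕ → Fin 2) : Prop :=
  ∃ x ∈ Set.Ico (0 : ℝ) 1, s = lowerCoding α x ∨ s = upperCoding α x

/-- The language of slope `α`: the set of all factors of Sturmian words of slope `α`. -/
def language (α : ℝ) : Set (List (Fin 2)) :=
  {w | ∃ s, IsSturmianOfSlope α s ∧ IsFactor w s}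

/-- The `k`-th partial quotient `a_k` of the continued fraction expansion
`α = [a_0; a_1, a_2, …]`, as a natural number (we use it for `0 < α` only). -/
noncomputable def partialQuotient (α : ℝ) (k : ℕ) : ℕ :=
  match GenContFract.IntFractPair.stream α k with
  | some p => p.b.toNat
  | none => 0

/-- The standard words `s_0 = 0`, `s_1 = 0 ^ (a_1 - 1) 1`, `s_k = s_{k-1} ^ a_k s_{k-2}`. -/
noncomputable def standardWord (α : ℝ) : ℕ → List (Fin 2)
  | 0 => [0]
  | 1 => wordPow [0] (partialQuotient α 1 - 1) ++ [1]
  | k + 2 => wordPow (standardWord α (k + 1)) (partialQuotient α (k + 2)) ++ standardWord α k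

/-- The words `s_{k,l} = s_{k-1} ^ l s_{k-2}`, used for `2 ≤ k` and `0 < l < a_k`, when they are
called semistandard. -/
noncomputable def semistandardWord (α : ℝ) (k l : ℕ) : List (Fin 2) :=
  wordPow (standardWord α (k - 1)) l ++ standardWord α (k - 2)

end Sturmian

/-! The proof is a renormalization. For `α < 1/2` no two 1s are adjacent, so a conjugate of `w`
beginning with 0 is the image of a shorter word `v` under `0 ↦ 0`, `1 ↦ 01`; this corresponds to
inducing the rotation on an interval of length `1 - α`, which gives the rotation by `β = α / (1 -
α)`, with `1/β = 1/α - 1`. For `α > 1/2`, exchanging the letters leads to `1 - α`. Induction on the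
length ends at a single letter (`renormalization_induction`).

On the sequence `a_1 - 1, a_2, a_3, …` these two moves lower the first term by 1 and delete a
leading 0, so standard words go to standard words (`inflate_directedWord`, `map_directedWord`).

What must survive each step is the occurrence of a power. From `w ^ (m + 1)` one gets the `m`-th
powers of all conjugates of `w`; those whose end letters differ desubstitute with no further loss
(`ConjPowCodes.of_inflate`). Squares are thus followed with `m = 1` and cubes with `m = 2`. The few
cases that this weaker information leaves open are settled by the gap between consecutive 1s. -/

namespace Sturmian

/-! ### Powers, conjugates and primitive words. -/

section Words

variable {A B : Type*}

theorem wordPow_zero (w : List A) : wordPow w 0 = [] := by simp [wordPow]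

theorem wordPow_succ (w : List A) (n : ℕ) : wordPow w (n + 1) = w ++ wordPow w n := by
  simp [wordPow, List.replicate_succ]

theorem wordPow_succ' (w : List A) (n : ℕ) : wordPow w (n + 1) = wordPow w n ++ w := by
  simp [wordPow, List.replicate_succ']

theorem wordPow_singleton (a : A) (n : ℕ) : wordPow [a] n = List.replicate n a := by
  simp [wordPow]

theorem map_wordPow (f : A → B) (w : List A) (n : ℕ) :
    (wordPow w n).map f = wordPow (w.map f) n := by
  induction n with
  | zero => simp [wordPow_zero]
  | succ n ih => simp [wordPow_succ, ih]

theorem flatMap_wordPow (f : A → List B) (w : List A) (n : ℕ) :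
    (wordPow w n).flatMap f = wordPow (w.flatMap f) n := by
  induction n with
  | zero => simp [wordPow_zero]
  | succ n ih => simp [wordPow_succ, ih]

theorem append_wordPow_append (u v : List A) (n : ℕ) :
    u ++ wordPow (v ++ u) n ++ v = wordPow (u ++ v) (n + 1) := by
  induction n with
  | zero => simp [wordPow_zero, wordPow_succ]
  | succ n ih => rw [wordPow_succ _ (n + 1), ← ih, wordPow_succ]; simp

theorem exists_append_of_isRotated {w w' : List A} (h : w ~r w') :
    ∃ u v, w = u ++ v ∧ w' = v ++ u := by
  obtain ⟨n, hn, rfl⟩ := List.isRotated_iff_mod.1 h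
  exact ⟨w.take n, w.drop n, (List.take_append_drop n w).symm,
    List.rotate_eq_drop_append_take hn⟩

theorem isRotated_flatMap (f : A → List B) {w w' : List A} (h : w ~r w') :
    w.flatMap f ~r w'.flatMap f := by
  obtain ⟨u, v, rfl, rfl⟩ := exists_append_of_isRotated h
  simpa using List.isRotated_append

theorem IsPrimitive.ne_nil {w : List A} (h : IsPrimitive w) : w ≠ [] := by
  rintro rfl
  exact absurd (h [] 0 (wordPow_zero _).symm) (by norm_num)

/-- Rotating an `n`-th power by one letter gives the `n`-th power of the rotated root, so a
conjugate of a power is again a power. -/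
theorem IsPrimitive.of_isRotated {w w' : List A} (h : IsPrimitive w) (hr : w ~r w') :
    IsPrimitive w' := by
  intro u n hn
  subst hn
  obtain ⟨x, y, hx, rfl⟩ := exists_append_of_isRotated hr.symm
  rcases n with _ | n
  · rw [wordPow_zero] at hx
    obtain ⟨rfl, rfl⟩ := List.append_eq_nil_iff.1 hx.symm
    exact absurd rfl h.ne_nil
  · have hi : (wordPow u (n + 1)).rotate x.length = y ++ x := by
      rw [hx, List.rotate_append_length_eq]
    have key : ∀ i, ∃ z, (wordPow u (n + 1)).rotate i = wordPow z (n + 1) := by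
      intro i
      induction i with
      | zero => exact ⟨u, by simp⟩
      | succ i ih =>
        obtain ⟨z, hz⟩ := ih
        rw [← List.rotate_rotate, hz]
        rcases z with _ | ⟨a, z⟩
        · exact ⟨[], by simp [wordPow]⟩
        · refine ⟨z ++ [a], ?_⟩
          have h1 := append_wordPow_append [a] z n
          have h2 := List.rotate_append_length_eq [a] (wordPow (z ++ [a]) n ++ z)
          rw [← List.append_assoc, h1] at h2
          rw [wordPow_succ' (z ++ [a]), ← List.append_assoc]
          exact h2
    obtain ⟨z, hz⟩ := key x.length
    exact h z (n + 1) (hi.symm.trans hz)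

theorem IsPrimitive.of_map {f : A → B} {w : List A} (h : IsPrimitive (w.map f)) :
    IsPrimitive w := by
  rintro u n rfl
  exact h _ n (map_wordPow f u n)

theorem IsPrimitive.of_flatMap {f : A → List B} {w : List A} (h : IsPrimitive (w.flatMap f)) :
    IsPrimitive w := by
  rintro u n rfl
  exact h _ n (flatMap_wordPow f u n)

theorem IsPrimitive.eq_singleton {w : List A} {a : A} (h : IsPrimitive w)
    (ha : ∀ b ∈ w, b = a) : w = [a] := by
  have h1 := List.eq_replicate_of_mem ha
  rw [← wordPow_singleton] at h1
  rw [h1, h [a] _ h1]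
  simp [wordPow]

theorem exists_isRotated_cons_append (w : List (Fin 2)) (h0 : 0 ∈ w) (h1 : 1 ∈ w) :
    ∃ p : List (Fin 2), (0 :: (p ++ [1])) ~r w := by
  have key : ∀ q r : List (Fin 2), 0 ∈ q → ∃ p : List (Fin 2),
      (0 :: (p ++ [1])) ~r (q ++ r ++ [1]) := by
    intro q
    induction q with
    | nil => simp
    | cons a q ih =>
      intro r hq
      obtain rfl | rfl : a = 0 ∨ a = 1 := by omega
      · exact ⟨q ++ r, by simp [List.IsRotated.refl]⟩
      · obtain ⟨p, hp⟩ := ih (r ++ [1]) (by simpa using hq)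
        refine ⟨p, hp.trans ?_⟩
        have : (q ++ r ++ [1]) ++ [1] ~r [1] ++ (q ++ r ++ [1]) := List.isRotated_append
        simpa using this
  obtain ⟨u, z, rfl⟩ := List.append_of_mem h1
  obtain ⟨p, hp⟩ := key (z ++ u) [] (by simpa [or_comm] using h0)
  refine ⟨p, hp.trans ?_⟩
  have : z ++ (u ++ [1]) ~r (u ++ [1]) ++ z := List.isRotated_append
  simpa using this

end Words

/-! ### Codings of orbits that avoid the endpoints, and desubstitution. -/

section Coding

/-- The word `w` codes the beginning of the orbit of `x`, and the orbit avoids the endpoints of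
the intervals of the coding. -/
def Codes (α : ℝ) : ℝ → List (Fin 2) → Prop
  | _, [] => True
  | x, a :: w =>
    if a = 0 then (0 < x ∧ x < 1 - α) ∧ Codes α (x + α) w
    else (1 - α < x ∧ x < 1) ∧ Codes α (x + α - 1) w

variable {α β x : ℝ} {v w : List (Fin 2)}

theorem codes_zero_cons :
    Codes α x (0 :: w) ↔ (0 < x ∧ x < 1 - α) ∧ Codes α (x + α) w := by
  simp [Codes]

theorem codes_one_cons :
    Codes α x (1 :: w) ↔ (1 - α < x ∧ x < 1) ∧ Codes α (x + α - 1) w := by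
  simp [Codes]

theorem Codes.left (h : Codes α x (v ++ w)) : Codes α x v := by
  induction v generalizing x with
  | nil => trivial
  | cons a v ih =>
    obtain rfl | rfl : a = 0 ∨ a = 1 := by omega
    · exact codes_zero_cons.2 ((codes_zero_cons.1 h).imp_right ih)
    · exact codes_one_cons.2 ((codes_one_cons.1 h).imp_right ih)

theorem Codes.right (h : Codes α x (v ++ w)) : ∃ y, Codes α y w := by
  induction v generalizing x with
  | nil => exact ⟨x, h⟩
  | cons a v ih =>
    obtain rfl | rfl : a = 0 ∨ a = 1 := by omega
    · exact ih (codes_zero_cons.1 h).2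
    · exact ih (codes_one_cons.1 h).2

theorem Codes.append_zero (hα2 : α < 1 / 2) (h : Codes α x (w ++ [1])) :
    Codes α x (w ++ [1] ++ [0]) := by
  induction w generalizing x with
  | nil =>
    have h1 := (codes_one_cons.1 h).1
    exact codes_one_cons.2 ⟨h1, codes_zero_cons.2 ⟨⟨by linarith, by linarith⟩, trivial⟩⟩
  | cons a w ih =>
    obtain rfl | rfl : a = 0 ∨ a = 1 := by omega
    · exact codes_zero_cons.2 ((codes_zero_cons.1 h).imp_right ih)
    · exact codes_one_cons.2 ((codes_one_cons.1 h).imp_right ih)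

theorem Codes.swap (h : Codes α x w) : Codes (1 - α) (1 - x) (w.map Fin.rev) := by
  induction w generalizing x with
  | nil => trivial
  | cons a w ih =>
    obtain rfl | rfl : a = 0 ∨ a = 1 := by omega
    · obtain ⟨h1, h2⟩ := codes_zero_cons.1 h
      refine codes_one_cons.2 ⟨⟨by linarith, by linarith⟩, ?_⟩
      convert ih h2 using 1
      ring
    · obtain ⟨h1, h2⟩ := codes_one_cons.1 h
      refine codes_zero_cons.2 ⟨⟨by linarith, by linarith⟩, ?_⟩
      convert ih h2 using 1
      ring

/-- The morphism `0 ↦ 0`, `1 ↦ 01`. -/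
def inflate (w : List (Fin 2)) : List (Fin 2) := w.flatMap fun a => if a = 0 then [0] else [0, 1]

/-- The morphism `0 ↦ 0`, `1 ↦ 10`. -/
def coinflate (w : List (Fin 2)) : List (Fin 2) :=
  w.flatMap fun a => if a = 0 then [0] else [1, 0]

@[simp] theorem inflate_nil : inflate [] = [] := rfl
@[simp] theorem inflate_zero_cons : inflate (0 :: w) = 0 :: inflate w := rfl
@[simp] theorem inflate_one_cons : inflate (1 :: w) = 0 :: 1 :: inflate w := rfl
@[simp] theorem coinflate_nil : coinflate [] = [] := rfl
@[simp] theorem coinflate_zero_cons : coinflate (0 :: w) = 0 :: coinflate w := rfl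
@[simp] theorem coinflate_one_cons : coinflate (1 :: w) = 1 :: 0 :: coinflate w := rfl

@[simp] theorem inflate_append : inflate (v ++ w) = inflate v ++ inflate w :=
  List.flatMap_append

@[simp] theorem coinflate_append : coinflate (v ++ w) = coinflate v ++ coinflate w :=
  List.flatMap_append

theorem inflate_wordPow (n : ℕ) : inflate (wordPow w n) = wordPow (inflate w) n :=
  flatMap_wordPow _ w n

theorem coinflate_wordPow (n : ℕ) : coinflate (wordPow w n) = wordPow (coinflate w) n :=
  flatMap_wordPow _ w n

theorem isRotated_inflate (h : v ~r w) : inflate v ~r inflate w := isRotated_flatMap _ h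

theorem zero_cons_coinflate (w : List (Fin 2)) : 0 :: coinflate w = inflate w ++ [0] := by
  induction w with
  | nil => rfl
  | cons a w ih =>
    obtain rfl | rfl : a = 0 ∨ a = 1 := by omega
    all_goals simpa using ih

theorem coinflate_isRotated (w : List (Fin 2)) : coinflate w ~r inflate w := by
  have h := zero_cons_coinflate w
  have h1 : inflate w = [] ∨ ∃ z, inflate w = 0 :: z := by
    rcases w with _ | ⟨a, w⟩
    · exact Or.inl rfl
    · obtain rfl | rfl : a = 0 ∨ a = 1 := by omega
      · exact Or.inr ⟨_, rfl⟩
      · exact Or.inr ⟨_, rfl⟩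
  rcases h1 with h1 | ⟨z, h1⟩
  · rw [h1] at h ⊢
    simp only [List.nil_append, List.cons.injEq, true_and] at h
    rw [h]
  · rw [h1] at h ⊢
    simp only [List.cons_append, List.cons.injEq, true_and] at h
    rw [h]
    exact List.isRotated_append (l := z) (l' := [0])

/-- The first return map to `(0, 1 - α)`, rescaled to unit length, is the rotation by `β`; the
blocks 0 and 01 record return times 1 and 2. -/
theorem codes_of_codes_inflate (hα2 : α < 1 / 2) (hβ : β * (1 - α) = α)
    (h : Codes α ((1 - α) * x) (inflate w ++ [0])) : Codes β x w := by
  have hc : 0 < 1 - α := by linarith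
  induction w generalizing x with
  | nil => trivial
  | cons a w ih =>
    -- Each return is below `1 - α` because the next letter is 0; the appended 0 covers the last
    -- return.
    have hz : ∀ {y}, Codes α y (inflate w ++ [0]) → y < 1 - α := by
      intro y hy
      rw [← zero_cons_coinflate] at hy
      exact (codes_zero_cons.1 hy).1.2
    obtain rfl | rfl : a = 0 ∨ a = 1 := by omega
    · rw [inflate_zero_cons, List.cons_append] at h
      obtain ⟨h1, h2⟩ := codes_zero_cons.1 h
      refine codes_zero_cons.2 ⟨⟨pos_of_mul_pos_right h1.1 hc.le, ?_⟩, ih ?_⟩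
      · refine lt_of_mul_lt_mul_left ?_ hc.le
        linarith [hz h2]
      · convert h2 using 1
        linarith
    · rw [inflate_one_cons, List.cons_append, List.cons_append] at h
      obtain ⟨h1, h2⟩ := codes_zero_cons.1 h
      obtain ⟨h3, h4⟩ := codes_one_cons.1 h2
      refine codes_one_cons.2 ⟨⟨?_, ?_⟩, ih ?_⟩
      · refine lt_of_mul_lt_mul_left ?_ hc.le
        linarith
      · refine lt_of_mul_lt_mul_left ?_ hc.le
        linarith
      · convert h4 using 1
        linarith

/-- The same with returns to `(α, 1)` and blocks 0 and 10. Here the lower bound on the starting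
point must be supplied and propagates along the orbit. -/
theorem codes_of_codes_coinflate (hα2 : α < 1 / 2) (hβ : β * (1 - α) = α) (hx : 0 < x)
    (h : Codes α ((1 - α) * x + α) (coinflate w)) : Codes β x w := by
  have hc : 0 < 1 - α := by linarith
  induction w generalizing x with
  | nil => trivial
  | cons a w ih =>
    have hx' : 0 < (1 - α) * x := mul_pos hc hx
    obtain rfl | rfl : a = 0 ∨ a = 1 := by omega
    · rw [coinflate_zero_cons] at h
      obtain ⟨h1, h2⟩ := codes_zero_cons.1 h
      refine codes_zero_cons.2 ⟨⟨hx, ?_⟩, ih ?_ ?_⟩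
      · refine lt_of_mul_lt_mul_left ?_ hc.le
        linarith
      · refine pos_of_mul_pos_right (a := 1 - α) ?_ hc.le
        linarith
      · convert h2 using 1
        linarith
    · rw [coinflate_one_cons] at h
      obtain ⟨h1, h2⟩ := codes_one_cons.1 h
      obtain ⟨h3, h4⟩ := codes_zero_cons.1 h2
      refine codes_one_cons.2 ⟨⟨?_, ?_⟩, ih ?_ ?_⟩
      · refine lt_of_mul_lt_mul_left ?_ hc.le
        linarith
      · refine lt_of_mul_lt_mul_left ?_ hc.le
        linarith
      · refine pos_of_mul_pos_right (a := 1 - α) ?_ hc.le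
        linarith
      · convert h4 using 1
        linarith

theorem exists_eq_inflate (hα2 : α < 1 / 2) (w : List (Fin 2)) (x : ℝ)
    (h : Codes α x (0 :: w)) : ∃ v, 0 :: w = inflate v := by
  match w with
  | [] => exact ⟨[0], rfl⟩
  | 0 :: w =>
    obtain ⟨v, hv⟩ := exists_eq_inflate hα2 w _ (codes_zero_cons.1 h).2
    exact ⟨0 :: v, by rw [hv]; rfl⟩
  | [1] => exact ⟨[1], rfl⟩
  | 1 :: 0 :: w =>
    obtain ⟨v, hv⟩ := exists_eq_inflate hα2 w _ (codes_one_cons.1 (codes_zero_cons.1 h).2).2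
    exact ⟨1 :: v, by rw [hv]; rfl⟩
  | 1 :: 1 :: w =>
    have h1 := codes_one_cons.1 (codes_zero_cons.1 h).2
    have h2 := codes_one_cons.1 h1.2
    linarith [h1.1.2, h2.1.1]

theorem Codes.lt_of_replicate {l : ℕ} (h : Codes α x (List.replicate l 0 ++ 1 :: w)) :
    1 - α < x + l * α := by
  induction l generalizing x with
  | zero => simpa using (codes_one_cons.1 h).1.1
  | succ l ih =>
    have := ih (codes_zero_cons.1 h).2
    push_cast
    linarith

/-- Just after a 1 the orbit is below `α`, and `l` steps later it must exceed `1 - α`. -/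
theorem Codes.one_lt_of_one_replicate_one {l : ℕ}
    (h : Codes α x (1 :: (List.replicate l 0 ++ 1 :: w))) : 1 < (l + 2) * α := by
  obtain ⟨h1, h2⟩ := codes_one_cons.1 h
  linarith [h2.lt_of_replicate]

/-- A small shift to the right moves a finite orbit off the closed left endpoints without changing
its coding. -/
theorem exists_codes_of_lowerCoding (hα0 : 0 < α) (hα1 : α < 1) (hx : x ∈ Set.Ico (0 : ℝ) 1)
    (h : ∀ (j : ℕ) (hj : j < w.length), w[j] = lowerCoding α x j) :
    ∃ ε > 0, ∀ t, 0 < t → t < ε → Codes α (x + t) w := by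
  induction w generalizing x with
  | nil => exact ⟨1, one_pos, fun _ _ _ => trivial⟩
  | cons a w ih =>
    have hr : rotation α x ∈ Set.Ico (0 : ℝ) 1 := ⟨Int.fract_nonneg _, Int.fract_lt_one _⟩
    obtain ⟨ε, hε, H⟩ := ih hr fun j hj => h (j + 1) (by simpa using hj)
    have h0 : a = lowerCoding α x 0 := h 0 (by simp)
    by_cases hxα : x < 1 - α
    · replace h0 : a = 0 := h0.trans (if_pos ⟨hx.1, hxα⟩)
      have hrx : rotation α x = x + α :=
        Int.fract_eq_self.2 ⟨by linarith [hx.1], by linarith⟩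
      refine ⟨min ε (1 - α - x), lt_min hε (by linarith), fun t ht ht' => ?_⟩
      rw [lt_min_iff] at ht'
      rw [h0]
      refine codes_zero_cons.2 ⟨⟨by linarith [hx.1], by linarith⟩, ?_⟩
      have := H t ht ht'.1
      rw [hrx] at this
      convert this using 1
      ring
    · replace h0 : a = 1 := h0.trans (if_neg fun h => hxα h.2)
      have hrx : rotation α x = x + α - 1 := by
        rw [rotation, Int.fract_eq_iff]
        exact ⟨by linarith, by linarith [hx.2], 1, by simp⟩
      refine ⟨min ε (1 - x), lt_min hε (by linarith [hx.2]), fun t ht ht' => ?_⟩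
      rw [lt_min_iff] at ht'
      rw [h0]
      refine codes_one_cons.2 ⟨⟨by linarith, by linarith⟩, ?_⟩
      have := H t ht ht'.1
      rw [hrx] at this
      convert this using 1
      ring

/-- Here the shift is to the left, so the point 0 of the circle is represented by 1. -/
theorem exists_codes_of_upperCoding (hα0 : 0 < α) (hα1 : α < 1) (hx : x ∈ Set.Ioc (0 : ℝ) 1)
    (h : ∀ (j : ℕ) (hj : j < w.length), w[j] = upperCoding α (Int.fract x) j) :
    ∃ ε > 0, ∀ t, 0 < t → t < ε → Codes α (x - t) w := by
  induction w generalizing x with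
  | nil => exact ⟨1, one_pos, fun _ _ _ => trivial⟩
  | cons a w ih =>
    have h0 : a = upperCoding α (Int.fract x) 0 := h 0 (by simp)
    have hr : rotation α (Int.fract x) = Int.fract (x + α) := by
      rw [rotation, Int.fract_eq_fract]
      exact ⟨-⌊x⌋, by rw [Int.fract]; push_cast; ring⟩
    have hs : ∀ (j : ℕ) (hj : j < w.length), w[j] = upperCoding α (Int.fract (x + α)) j := by
      intro j hj
      rw [← hr]
      exact h (j + 1) (by simpa using hj)
    by_cases hxα : x ≤ 1 - α
    · have hf : Int.fract x = x := Int.fract_eq_self.2 ⟨hx.1.le, by linarith⟩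
      rw [hf] at h0
      replace h0 : a = 0 := h0.trans (if_pos ⟨hx.1, hxα⟩)
      obtain ⟨ε, hε, H⟩ := ih (x := x + α) ⟨by linarith [hx.1], by linarith⟩ hs
      refine ⟨min ε x, lt_min hε hx.1, fun t ht ht' => ?_⟩
      rw [lt_min_iff] at ht'
      rw [h0]
      refine codes_zero_cons.2 ⟨⟨by linarith, by linarith⟩, ?_⟩
      convert H t ht ht'.1 using 1
      ring
    · have hf : ¬ (Int.fract x ∈ Set.Ioc 0 (1 - α)) := by
        rcases hx.2.eq_or_lt with rfl | hx1
        · simp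
        · rw [Int.fract_eq_self.2 ⟨hx.1.le, hx1⟩]
          exact fun h => hxα h.2
      replace h0 : a = 1 := h0.trans (if_neg hf)
      obtain ⟨ε, hε, H⟩ := ih (x := x + α - 1) ⟨by linarith, by linarith [hx.2]⟩
        (by simpa only [Int.fract_sub_one] using hs)
      refine ⟨min ε (x - (1 - α)), lt_min hε (by linarith), fun t ht ht' => ?_⟩
      rw [lt_min_iff] at ht'
      rw [h0]
      refine codes_one_cons.2 ⟨⟨by linarith, by linarith [hx.2]⟩, ?_⟩
      convert H t ht ht'.1 using 1
      ring

theorem exists_codes_of_mem_language (hα0 : 0 < α) (hα1 : α < 1) (hw : w ∈ language α) :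
    ∃ x, Codes α x w := by
  obtain ⟨s, ⟨x, hx, hs⟩, i, hi⟩ := hw
  have hy : (rotation α)^[i] x ∈ Set.Ico (0 : ℝ) 1 := by
    rw [rotation_iterate α hx]
    exact ⟨Int.fract_nonneg _, Int.fract_lt_one _⟩
  rcases hs with rfl | rfl
  · obtain ⟨ε, hε, H⟩ := exists_codes_of_lowerCoding (w := w) hα0 hα1 hy fun j hj => by
      rw [hi j hj, lowerCoding, lowerCoding, ← Function.iterate_add_apply, add_comm]
    exact ⟨_, H (ε / 2) (by linarith) (by linarith)⟩
  · have hh : ∀ (j : ℕ) (hj : j < w.length), w[j] = upperCoding α ((rotation α)^[i] x) j := by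
      intro j hj
      rw [hi j hj, upperCoding, upperCoding, ← Function.iterate_add_apply, add_comm]
    obtain ⟨y, hy1, hy2⟩ : ∃ y ∈ Set.Ioc (0 : ℝ) 1, Int.fract y = (rotation α)^[i] x := by
      rcases hy.1.eq_or_lt with h | h
      · exact ⟨1, by simp, by rw [← h]; simp⟩
      · exact ⟨_, ⟨h, hy.2.le⟩, Int.fract_eq_self.2 hy⟩
    obtain ⟨ε, hε, H⟩ := exists_codes_of_upperCoding (w := w) hα0 hα1 hy1 (by rwa [hy2])
    exact ⟨_, H (ε / 2) (by linarith) (by linarith)⟩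

end Coding

/-! ### Renormalization of powers and the induction on length. -/

section Renormalization

variable {α β : ℝ} {m : ℕ} {v w : List (Fin 2)}

/-- The `m`-th powers of those conjugates of `w` whose first and last letters differ occur in the
coding of the rotation by `α`. -/
def ConjPowCodes (m : ℕ) (α : ℝ) (w : List (Fin 2)) : Prop :=
  ∀ (a b : Fin 2) (p : List (Fin 2)), a ≠ b → (a :: (p ++ [b])) ~r w →
    ∃ x, Codes α x (wordPow (a :: (p ++ [b])) m)

/-- The identity `(vu)^(m+1) = v (uv)^m u` costs one factor, once and for all. -/
theorem conjPowCodes_of_codes {x : ℝ} (h : Codes α x (wordPow w (m + 1))) :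
    ConjPowCodes m α w := by
  intro a b p _ hr
  obtain ⟨u, v, h1, rfl⟩ := exists_append_of_isRotated hr
  rw [h1]
  rw [← append_wordPow_append, List.append_assoc] at h
  obtain ⟨y, hy⟩ := h.right
  exact ⟨y, hy.left⟩

theorem ConjPowCodes.of_isRotated (h : ConjPowCodes m α w) (hr : w ~r v) :
    ConjPowCodes m α v := fun a b p hab hp => h a b p hab (hp.trans hr.symm)

theorem map_rev_map_rev (w : List (Fin 2)) : (w.map Fin.rev).map Fin.rev = w := by
  rw [List.map_map, Fin.rev_involutive.comp_self, List.map_id]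

theorem ConjPowCodes.swap (h : ConjPowCodes m α w) :
    ConjPowCodes m (1 - α) (w.map Fin.rev) := by
  intro a b p hab hp
  have h1 := hp.map Fin.rev
  rw [map_rev_map_rev] at h1
  obtain ⟨x, hx⟩ := h a.rev b.rev (p.map Fin.rev) (by simpa using hab) (by simpa using h1)
  have h2 := hx.swap
  rw [map_wordPow, List.map_cons, List.map_append, map_rev_map_rev] at h2
  exact ⟨_, by simpa using h2⟩

/-- A conjugate `0p1` is desubstituted by `inflate`: its power ends in 1, so a 0 must follow. A
conjugate `1p0` is desubstituted by `coinflate`: its power starts with 1, so the orbit starts above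
`1 - α > α`. The exponent `m` is kept in both cases. -/
theorem ConjPowCodes.of_inflate (hα0 : 0 < α) (hα2 : α < 1 / 2) (hβ : β * (1 - α) = α)
    (hm : 1 ≤ m) (h : ConjPowCodes m α (inflate v)) : ConjPowCodes m β v := by
  obtain ⟨m, rfl⟩ := Nat.exists_eq_add_of_le' hm
  have hc : 0 < 1 - α := by linarith
  intro a b p hab hp
  obtain ⟨rfl, rfl⟩ | ⟨rfl, rfl⟩ : (a = 0 ∧ b = 1) ∨ (a = 1 ∧ b = 0) := by omega
  · obtain ⟨x, hx⟩ := h 0 1 (inflate p ++ [0]) hab (by simpa using isRotated_inflate hp)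
    have h1 : (0 :: (inflate p ++ [0] ++ [1])) = inflate (0 :: (p ++ [1])) := by simp
    have h2 := hx
    rw [wordPow_succ', ← List.cons_append, ← List.append_assoc] at h2
    replace h2 := h2.append_zero hα2
    rw [List.append_assoc _ _ [1], List.cons_append, ← wordPow_succ', h1,
      ← inflate_wordPow] at h2
    refine ⟨x / (1 - α), codes_of_codes_inflate hα2 hβ ?_⟩
    rwa [mul_div_cancel₀ _ hc.ne']
  · obtain ⟨x, hx⟩ := h 1 0 (0 :: coinflate p) hab (by
      simpa using (coinflate_isRotated _).trans (isRotated_inflate hp))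
    have h1 : (1 :: (0 :: coinflate p ++ [0])) = coinflate (1 :: (p ++ [0])) := by simp
    have h2 := hx
    rw [wordPow_succ] at h2
    have h3 := (codes_one_cons.1 h2).1.1
    rw [h1, ← coinflate_wordPow] at hx
    refine ⟨(x - α) / (1 - α), codes_of_codes_coinflate hα2 hβ
      (div_pos (by linarith) hc) ?_⟩
    rwa [mul_div_cancel₀ _ hc.ne', sub_add_cancel]

theorem length_lt_length_inflate (h : 1 ∈ v) : v.length < (inflate v).length := by
  have key : ∀ u, u.length ≤ (inflate u).length := by
    intro u
    induction u with
    | nil => simp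
    | cons a u ih =>
      obtain rfl | rfl : a = 0 ∨ a = 1 := by omega
      · simpa using ih
      · exact (Nat.succ_le_succ ih).trans (Nat.le_succ _)
  obtain ⟨s, t, rfl⟩ := List.append_of_mem h
  have h1 := key s
  have h2 := key t
  simp
  omega

theorem one_mem_of_one_mem_inflate (h : 1 ∈ inflate v) : 1 ∈ v := by
  obtain ⟨a, ha, h⟩ := List.mem_flatMap.1 h
  obtain rfl | rfl : a = 0 ∨ a = 1 := by omega
  · simp at h
  · exact ha

theorem irrational_renormalization (hα : Irrational α) (hα2 : α < 1 / 2)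
    (hβ : β * (1 - α) = α) : Irrational β := by
  have hc : 1 - α ≠ 0 := by linarith
  rintro ⟨q, rfl⟩
  have h1 : (1 + (q : ℝ)) * α = q := by linarith
  have h2 : 1 + (q : ℝ) ≠ 0 := by
    intro h
    rw [h, zero_mul] at h1
    rw [← h1] at h
    norm_num at h
  exact hα ⟨q / (1 + q), by push_cast; rw [div_eq_iff h2]; linarith⟩

/-- The premise `step` retains the powers at slope `α`, since the case `m = 2` needs them to exclude
a word. -/
theorem renormalization_induction (hm : 1 ≤ m) {P : ℝ → List (Fin 2) → Prop}
    (rot : ∀ α v w, v ~r w → P α v → P α w)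
    (zero : ∀ α, P α [0]) (one : ∀ α, P α [1])
    (swap : ∀ α w, Irrational α → 1 / 2 < α → α < 1 → P (1 - α) (w.map Fin.rev) → P α w)
    (step : ∀ α β v, Irrational α → 0 < α → α < 1 / 2 → β * (1 - α) = α →
      ConjPowCodes m α (inflate v) → P β v → P α (inflate v))
    (hα : Irrational α) (hα0 : 0 < α) (hα1 : α < 1) (hprim : IsPrimitive w)
    (hw : ConjPowCodes m α w) : P α w := by
  induction hn : w.length using Nat.strong_induction_on generalizing α w with
  | _ n ih =>
  subst hn
  -- Exchanging letters keeps the length, so it cannot use the induction hypothesis; the case of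
  -- slope below 1/2 is proved for all words of this length.
  have main : ∀ {γ : ℝ} {u : List (Fin 2)}, Irrational γ → 0 < γ → γ < 1 / 2 →
      u.length = w.length → IsPrimitive u → ConjPowCodes m γ u → P γ u := by
    intro γ u hγ hγ0 hγ2 hu hup huc
    by_cases h0 : 0 ∈ u
    · by_cases h1 : 1 ∈ u
      · obtain ⟨p, hp⟩ := exists_isRotated_cons_append u h0 h1
        obtain ⟨x, hx⟩ := huc 0 1 p (by decide) hp
        obtain ⟨k, rfl⟩ := Nat.exists_eq_add_of_le' hm
        rw [wordPow_succ] at hx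
        obtain ⟨v, hv⟩ := exists_eq_inflate hγ2 _ _ hx.left
        rw [hv] at hp
        have hc : 0 < 1 - γ := by linarith
        have hβ : γ / (1 - γ) * (1 - γ) = γ := div_mul_cancel₀ _ hc.ne'
        have huc' := huc.of_isRotated hp.symm
        have hlt : v.length < w.length := by
          rw [← hu, ← hp.perm.length_eq]
          exact length_lt_length_inflate (one_mem_of_one_mem_inflate (hp.mem_iff.2 h1))
        refine rot γ _ _ hp (step γ _ v hγ hγ0 hγ2 hβ huc' ?_)
        exact ih _ hlt (irrational_renormalization hγ hγ2 hβ) (div_pos hγ0 hc)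
          ((div_lt_one hc).2 (by linarith)) (hup.of_isRotated hp.symm).of_flatMap
          (huc'.of_inflate hγ0 hγ2 hβ hm) rfl
      · rw [hup.eq_singleton (a := 0) fun b hb => by
          have : b ≠ 1 := fun h => h1 (h ▸ hb)
          omega]
        exact zero γ
    · rw [hup.eq_singleton (a := 1) fun b hb => by
        have : b ≠ 0 := fun h => h0 (h ▸ hb)
        omega]
      exact one γ
  have hne : α ≠ 1 / 2 := by
    rintro rfl
    exact hα ⟨1 / 2, by norm_num⟩
  rcases hne.lt_or_gt with h | h
  · exact main hα hα0 h rfl hprim hw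
  · refine swap α w hα h hα1 (main ?_ (by linarith) (by linarith) (by simp) ?_ hw.swap)
    · simpa using hα.ratCast_sub 1
    · exact IsPrimitive.of_map (f := Fin.rev) (by rwa [map_rev_map_rev])

end Renormalization

/-! ### Continued fractions, standard words and the two classifications. -/

section StandardWords

variable {α β : ℝ}

theorem partialQuotient_zero (α : ℝ) : partialQuotient α 0 = ⌊α⌋.toNat := rfl

theorem partialQuotient_succ (h : Int.fract α ≠ 0) (k : ℕ) :
    partialQuotient α (k + 1) = partialQuotient (Int.fract α)⁻¹ k := by
  rw [partialQuotient, partialQuotient, GenContFract.IntFractPair.stream_succ h]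

theorem partialQuotient_succ_eq (h0 : 0 < α) (h1 : α < 1) (k : ℕ) :
    partialQuotient α (k + 1) = partialQuotient α⁻¹ k := by
  have h : Int.fract α = α := Int.fract_eq_self.2 ⟨h0.le, h1⟩
  rw [partialQuotient_succ (by rw [h]; exact h0.ne'), h]

theorem partialQuotient_add_one_succ (hα : Irrational α) (k : ℕ) :
    partialQuotient (α + 1) (k + 1) = partialQuotient α (k + 1) := by
  have h : Int.fract α ≠ 0 := by
    intro h
    exact hα ⟨⌊α⌋, by rw [Int.fract, sub_eq_zero] at h; simpa using h.symm⟩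
  rw [partialQuotient_succ (by rwa [Int.fract_add_one]), Int.fract_add_one,
    partialQuotient_succ h]

theorem partialQuotient_add_one_zero (hα : 0 < α) :
    partialQuotient (α + 1) 0 = partialQuotient α 0 + 1 := by
  have := Int.floor_nonneg.2 hα.le
  rw [partialQuotient_zero, partialQuotient_zero, Int.floor_add_one]
  omega

/-- The exponents `a_1 - 1, a_2, a_3, …` in the recursion for the standard words. -/
noncomputable def exponent (α : ℝ) : ℕ → ℕ
  | 0 => partialQuotient α 1 - 1
  | k + 1 => partialQuotient α (k + 2)

/-- The words `1, 0, s_1, s_2, …` built from the exponents `d`. -/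
def directedWord (d : ℕ → ℕ) : ℕ → List (Fin 2)
  | 0 => [1]
  | 1 => [0]
  | k + 2 => wordPow (directedWord d (k + 1)) (d k) ++ directedWord d k

theorem exponent_zero_of_half_lt (h : 1 / 2 < α) (h1 : α < 1) : exponent α 0 = 0 := by
  have h0 : 0 < α := by linarith
  have : ⌊α⁻¹⌋ < 2 := by
    rw [Int.floor_lt, inv_lt_comm₀ h0 (by norm_num)]
    push_cast
    linarith
  rw [exponent, partialQuotient_succ_eq h0 h1, partialQuotient_zero]
  omega

/-- If `α = [0; 1, a_2, a_3, …]` then `1 - α = [0; a_2 + 1, a_3, …]`; the subtraction of 1 in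
`exponent` turns this into a shift. -/
theorem exponent_succ_of_half_lt (hα : Irrational α) (h : 1 / 2 < α) (h1 : α < 1) (k : ℕ) :
    exponent α (k + 1) = exponent (1 - α) k := by
  have h0 : 0 < α := by linarith
  have hc : 0 < 1 - α := by linarith
  set γ := (1 - α)⁻¹ - 1 with hγ
  have hγ0 : 0 < γ := by
    have := (one_lt_inv₀ hc).2 (by linarith)
    linarith
  have hγi : Irrational γ := by
    have h2 : Irrational (1 - α) := by simpa using hα.ratCast_sub 1
    simpa using h2.inv.sub_ratCast 1
  have hf : (Int.fract α⁻¹)⁻¹ = γ := by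
    have : Int.fract α⁻¹ = α⁻¹ - 1 := by
      rw [Int.fract_eq_iff]
      have := (one_lt_inv₀ h0).2 h1
      have := (inv_lt_comm₀ h0 (by norm_num : (0 : ℝ) < 2)).2 (by linarith)
      exact ⟨by linarith, by linarith, 1, by simp⟩
    rw [this, hγ]
    have h3 : α⁻¹ - 1 = (1 - α) / α := by field_simp
    rw [h3, inv_div]
    field_simp
    ring
  have hne : Int.fract α⁻¹ ≠ 0 := by
    intro h
    rw [h, inv_zero] at hf
    exact hγ0.ne hf
  have hβ : (1 - α)⁻¹ = γ + 1 := by rw [hγ]; ring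
  rw [exponent, partialQuotient_succ_eq h0 h1, partialQuotient_succ hne, hf]
  rcases k with _ | k
  · rw [exponent, partialQuotient_succ_eq hc (by linarith), hβ,
      partialQuotient_add_one_zero hγ0, Nat.add_sub_cancel]
  · rw [exponent, partialQuotient_succ_eq hc (by linarith), hβ,
      partialQuotient_add_one_succ hγi]

theorem inv_renormalization (hα0 : 0 < α) (hα2 : α < 1 / 2) (hβ : β * (1 - α) = α) :
    0 < β ∧ β < 1 ∧ α⁻¹ = β⁻¹ + 1 := by
  have hc : 0 < 1 - α := by linarith
  obtain rfl : β = α / (1 - α) := by rw [eq_div_iff hc.ne', hβ]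
  refine ⟨div_pos hα0 hc, (div_lt_one hc).2 (by linarith), ?_⟩
  rw [inv_div]
  field_simp
  ring

theorem exponent_zero_renormalization (hα0 : 0 < α) (hα2 : α < 1 / 2)
    (hβ : β * (1 - α) = α) : exponent α 0 = exponent β 0 + 1 := by
  obtain ⟨h0, h1, h⟩ := inv_renormalization hα0 hα2 hβ
  rw [exponent, exponent, partialQuotient_succ_eq hα0 (by linarith), h,
    partialQuotient_add_one_zero (inv_pos.2 h0), partialQuotient_succ_eq h0 h1,
    partialQuotient_zero]
  have : 1 ≤ ⌊β⁻¹⌋ := Int.le_floor.2 (by simpa using (one_lt_inv₀ h0).2 h1 |>.le)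
  omega

theorem exponent_succ_renormalization (hα : Irrational α) (hα0 : 0 < α) (hα2 : α < 1 / 2)
    (hβ : β * (1 - α) = α) (k : ℕ) : exponent α (k + 1) = exponent β (k + 1) := by
  obtain ⟨h0, h1, h⟩ := inv_renormalization hα0 hα2 hβ
  rw [exponent, exponent, partialQuotient_succ_eq hα0 (by linarith), h,
    partialQuotient_add_one_succ (irrational_renormalization hα hα2 hβ).inv,
    partialQuotient_succ_eq h0 h1]

theorem directedWord_exponent_succ (α : ℝ) (k : ℕ) :
    directedWord (exponent α) (k + 1) = standardWord α k := by
  induction k using Nat.strong_induction_on with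
  | _ k ih =>
  match k with
  | 0 => rfl
  | 1 => rfl
  | k + 2 =>
    rw [directedWord, ih (k + 1) (by omega), ih k (by omega)]
    rfl

theorem map_directedWord {d d' : ℕ → ℕ} (h0 : d 0 = 0) (h : ∀ k, d (k + 1) = d' k) (k : ℕ) :
    (directedWord d' k).map Fin.rev = directedWord d (k + 1) := by
  induction k using Nat.strong_induction_on with
  | _ k ih =>
  match k with
  | 0 => rfl
  | 1 =>
    rw [directedWord, directedWord, h0]
    rfl
  | k + 2 =>
    rw [directedWord, directedWord, List.map_append, map_wordPow, ih (k + 1) (by omega),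
      ih k (by omega), h]

/-- The index starts at 1 because the word 1 is sent to 01, which need not be a directed word. -/
theorem inflate_directedWord {d d' : ℕ → ℕ} (h0 : d 0 = d' 0 + 1)
    (h : ∀ k, d (k + 1) = d' (k + 1)) (k : ℕ) :
    inflate (directedWord d' (k + 1)) = directedWord d (k + 1) := by
  induction k using Nat.strong_induction_on with
  | _ k ih =>
  match k with
  | 0 => rfl
  | 1 =>
    change inflate (wordPow [0] (d' 0) ++ [1]) = wordPow [0] (d 0) ++ [1]
    rw [h0, inflate_append, inflate_wordPow, wordPow_succ']
    simp
  | k + 2 =>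
    change inflate (wordPow (directedWord d' (k + 2)) (d' (k + 1)) ++ directedWord d' (k + 1)) =
      wordPow (directedWord d (k + 2)) (d (k + 1)) ++ directedWord d (k + 1)
    rw [inflate_append, inflate_wordPow, ih (k + 1) (by omega),
      ih k (by omega), h]

theorem isRotated_map_rev {v w : List (Fin 2)} (h : w.map Fin.rev ~r v) :
    w ~r v.map Fin.rev := by
  simpa only [map_rev_map_rev] using h.map Fin.rev

theorem exists_isRotated_of_conjPowCodes_one {w : List (Fin 2)} (hα : Irrational α)
    (hα0 : 0 < α) (hα1 : α < 1) (hprim : IsPrimitive w) (hw : ConjPowCodes 1 α w) :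
    ∃ k l, l ≤ exponent α k ∧ w ~r wordPow (directedWord (exponent α) (k + 1)) l ++
      directedWord (exponent α) k := by
  refine renormalization_induction (m := 1) (P := fun α w => ∃ k l, l ≤ exponent α k ∧
    w ~r wordPow (directedWord (exponent α) (k + 1)) l ++ directedWord (exponent α) k) le_rfl
    ?_ ?_ ?_ ?_ ?_ hα hα0 hα1 hprim hw
  · rintro α v w hvw ⟨k, l, hl, h⟩
    exact ⟨k, l, hl, hvw.symm.trans h⟩
  · exact fun α => ⟨1, 0, Nat.zero_le _, List.IsRotated.refl _⟩
  · exact fun α => ⟨0, 0, Nat.zero_le _, List.IsRotated.refl _⟩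
  · rintro α w hα h2 h1 ⟨k, l, hl, h⟩
    have hs := exponent_succ_of_half_lt hα h2 h1
    refine ⟨k + 1, l, by rwa [hs], ?_⟩
    have h3 := isRotated_map_rev h
    rwa [List.map_append, map_wordPow, map_directedWord (exponent_zero_of_half_lt h2 h1) hs,
      map_directedWord (exponent_zero_of_half_lt h2 h1) hs] at h3
  · rintro α β v hα h0 h2 hβ - ⟨k, l, hl, h⟩
    have hz := exponent_zero_renormalization h0 h2 hβ
    have hs := exponent_succ_renormalization hα h0 h2 hβ
    have h3 := isRotated_inflate h
    rw [inflate_append, inflate_wordPow, inflate_directedWord hz hs] at h3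
    rcases k with _ | k
    -- `0^l 1` inflates to `0^(l+1) 1`, and the bound on `l` also grows by 1.
    · refine ⟨0, l + 1, by omega, ?_⟩
      rw [wordPow_succ']
      simpa [directedWord] using h3
    · rw [inflate_directedWord hz hs] at h3
      exact ⟨k + 1, l, by rwa [hs], h3⟩

theorem exponent_zero_le {l : ℕ} (hα0 : 0 < α) (hα1 : α < 1) (h : 1 < (l + 2) * α) :
    exponent α 0 ≤ l := by
  rw [exponent, partialQuotient_succ_eq hα0 hα1, partialQuotient_zero]
  have : ⌊α⁻¹⌋ < (l + 2 : ℤ) := by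
    rw [Int.floor_lt, inv_lt_iff_one_lt_mul₀ hα0]
    push_cast
    linarith
  omega

theorem exists_isRotated_of_conjPowCodes_two {w : List (Fin 2)} (hα : Irrational α)
    (hα0 : 0 < α) (hα1 : α < 1) (hprim : IsPrimitive w) (hw : ConjPowCodes 2 α w) :
    ∃ k, w ~r directedWord (exponent α) k := by
  refine renormalization_induction (m := 2) (P := fun α w => ∃ k,
    w ~r directedWord (exponent α) k) (by norm_num)
    ?_ ?_ ?_ ?_ ?_ hα hα0 hα1 hprim hw
  · rintro α v w hvw ⟨k, h⟩
    exact ⟨k, hvw.symm.trans h⟩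
  · exact fun α => ⟨1, List.IsRotated.refl _⟩
  · exact fun α => ⟨0, List.IsRotated.refl _⟩
  · rintro α w hα h2 h1 ⟨k, h⟩
    have hs := exponent_succ_of_half_lt hα h2 h1
    refine ⟨k + 1, ?_⟩
    have h3 := isRotated_map_rev h
    rwa [map_directedWord (exponent_zero_of_half_lt h2 h1) hs] at h3
  · rintro α β v hα h0 h2 hβ hc ⟨k, h⟩
    have hz := exponent_zero_renormalization h0 h2 hβ
    have hs := exponent_succ_renormalization hα h0 h2 hβ
    have h3 := isRotated_inflate h
    rcases k with _ | k
    -- Here `inflate v` is conjugate to 01. The factor 101 of 0101 forces `3α > 1`, so the first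
    -- exponent is 1 and 01 is the directed word of index 2.
    · obtain ⟨x, hx⟩ := hc 0 1 [] (by decide) h3.symm
      have h4 := (codes_zero_cons.1 hx).2
      have h5 := Codes.one_lt_of_one_replicate_one (l := 1) (w := []) h4
      have h6 := exponent_zero_le h0 (by linarith) h5
      have h7 : exponent α 0 = 1 := by omega
      refine ⟨2, ?_⟩
      rw [directedWord, h7]
      exact h3
    · rw [inflate_directedWord hz hs] at h3
      exact ⟨k + 1, h3⟩

/-- The square of any conjugate of `0^l 1` contains `1 0^l 1`. This uses the full square, not just
the conjugates, and excludes the words `0^l 1` with `l < a_1 - 1`. -/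
theorem le_of_isRotated_of_codes_sq {w : List (Fin 2)} {l : ℕ} {x : ℝ} (hα0 : 0 < α)
    (hα1 : α < 1) (h : w ~r (List.replicate l 0 ++ [1])) (hx : Codes α x (wordPow w 2)) :
    exponent α 0 ≤ l := by
  obtain ⟨p, q, rfl⟩ := List.append_of_mem (h.mem_iff.2 (by simp) : (1 : Fin 2) ∈ w)
  have h1 : (q ++ p).Perm (List.replicate l 0) := by
    have h2 := List.perm_middle.symm.trans (h.perm.trans List.perm_append_comm)
    exact List.perm_append_comm.trans h2.cons_inv
  rw [List.perm_replicate] at h1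
  have h3 : wordPow (p ++ 1 :: q) 2 = p ++ 1 :: (q ++ p ++ 1 :: q) := by
    simp [wordPow_succ, wordPow_zero]
  rw [h3, h1] at hx
  obtain ⟨y, hy⟩ := hx.right
  exact exponent_zero_le hα0 hα1 hy.one_lt_of_one_replicate_one

theorem two_lt_partialQuotient_one {x : ℝ} (hα0 : 0 < α) (hα1 : α < 1)
    (hx : Codes α x (wordPow [0] 3)) : 2 < partialQuotient α 1 := by
  obtain ⟨h1, h2⟩ := codes_zero_cons.1 hx
  obtain ⟨h3, h4⟩ := codes_zero_cons.1 h2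
  have h5 := (codes_zero_cons.1 h4).1
  have : 3 ≤ ⌊α⁻¹⌋ := by
    rw [Int.le_floor, le_inv_comm₀ (by norm_num) hα0]
    push_cast
    linarith
  rw [partialQuotient_succ_eq hα0 hα1, partialQuotient_zero]
  omega

end StandardWords

end Sturmian

/-! ### The theorem on squares and cubes. -/

theorem mainTheorem5 (α : ℝ) (hα : Irrational α) (hα0 : 0 < α) (hα2 : α < 1 / 2)
    (w : List (Fin 2)) (hw : w ∈ Sturmian.language α) (hprim : Sturmian.IsPrimitive w) :
    (Sturmian.wordPow w 2 ∈ Sturmian.language α →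
      (∃ k : ℕ, w ~r Sturmian.standardWord α k) ∨
      (∃ k l : ℕ, 2 ≤ k ∧ 0 < l ∧ l < Sturmian.partialQuotient α k ∧
        w ~r Sturmian.semistandardWord α k l)) ∧
    (Sturmian.wordPow w 3 ∈ Sturmian.language α →
      (w = [0] ∧ 2 < Sturmian.partialQuotient α 1) ∨
      (∃ k : ℕ, 1 ≤ k ∧ w ~r Sturmian.standardWord α k)) := by
  have hα1 : α < 1 := by linarith
  constructor
  · intro h
    obtain ⟨x, hx⟩ := Sturmian.exists_codes_of_mem_language hα0 hα1 h
    obtain ⟨k, l, hl, hr⟩ := Sturmian.exists_isRotated_of_conjPowCodes_one hα hα0 hα1 hprim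
      (Sturmian.conjPowCodes_of_codes hx)
    rcases hl.eq_or_lt with rfl | hl
    -- At the maximal `l` the word is the next directed word.
    · exact Or.inl ⟨k + 1, by rwa [← Sturmian.directedWord_exponent_succ]⟩
    rcases k with _ | k
    · rw [Sturmian.directedWord, Sturmian.directedWord, Sturmian.wordPow_singleton] at hr
      exact absurd (Sturmian.le_of_isRotated_of_codes_sq hα0 hα1 hr hx) hl.not_ge
    rw [Sturmian.directedWord_exponent_succ, Sturmian.directedWord_exponent_succ] at hr
    rcases l.eq_zero_or_pos with rfl | hl0
    · exact Or.inl ⟨k, by simpa [Sturmian.wordPow_zero] using hr⟩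
    · exact Or.inr ⟨k + 2, l, by omega, hl0, hl, hr⟩
  · intro h
    obtain ⟨x, hx⟩ := Sturmian.exists_codes_of_mem_language hα0 hα1 h
    obtain ⟨k, hr⟩ := Sturmian.exists_isRotated_of_conjPowCodes_two hα hα0 hα1 hprim
      (Sturmian.conjPowCodes_of_codes hx)
    match k with
    | 0 =>
      -- Excluded, since 11 does not occur when `α < 1/2`.
      obtain rfl : w = [1] := by simpa [Sturmian.directedWord] using hr
      have h1 := Sturmian.codes_one_cons.1 hx
      have h2 := Sturmian.codes_one_cons.1 h1.2
      linarith [h1.1.2, h2.1.1]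
    | 1 =>
      obtain rfl : w = [0] := by simpa [Sturmian.directedWord] using hr
      exact Or.inl ⟨rfl, Sturmian.two_lt_partialQuotient_one hα0 hα1 hx⟩
    | k + 2 =>
      exact Or.inr ⟨k + 1, by omega, by rwa [← Sturmian.directedWord_exponent_succ]⟩
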